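/- Fix $r\ge 2$ and constants $K_1,K_2>0$. For each $n$ let $\boldsymbol A_n=(a_{i_1,\ldots,i_r})_{1\le i_1,\ldots,i_r\le n}$ be a real $r$-tensor (its entries may depend on $n$) such that, for all sufficiently large $n$: (1) for every $1\le s\le r$ and all $i_1,\ldots,i_{s-1},i_{s+1},\ldots,i_r\in\{1,\ldots,n\}$, $\sum_{i_s=1}^n a_{i_1,\ldots,i_r}=0$; (2) $|a_{i_1,\ldots,i_r}|\le K_1/\sqrt n$ for all $i_1,\ldots,i_r\in\{1,\ldots,n\}$, and $\sum_{1\le i_1,\ldots,i_r\le n}a_{i_1,\ldots,i_r}^2\ge K_2\,n^{r-1}$. For each $n$ let $\pi_1,\ldots,\pi_{r-1}$ be independent, uniformly distributed random permutations of $\{1,\ldots,n\}$, and put $$C_n=\sum_{i=1}^n a_{i,\pi_1(i),\ldots,\pi_{r-1}(i)}.$$ Then, as $n\to\infty$, $$\frac{C_n}{\sqrt{\operatorname{Var}(C_n)}}\ \longrightarrow\ N(0,1)\quad\text{in distribution}.$$ -/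

import Mathlib

open MeasureTheory ProbabilityTheory Filter

namespace TensorCLT

/-- Permutations of a finite set carry the discrete σ-algebra. -/
instance instMeasurableSpacePerm (n : ℕ) : MeasurableSpace (Equiv.Perm (Fin n)) := ⊤

/-- An `r`-tensor of side length `n`: a real number `A i` for each multi-index
`i = (i₁, …, iᵣ)` with entries in an `n`-element set. -/
abbrev Tensor (r n : ℕ) : Type := (Fin r → Fin n) → ℝ

/-- `A` is centered in every index: for each position `s` and each choice of the other indices,
the sum of the entries over the `s`-th index is zero (the value `i s` is overwritten by `j`). -/
def Tensor.IsCentered {r n : ℕ} (A : Tensor r n) : Prop :=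
  ∀ (s : Fin r) (i : Fin r → Fin n), ∑ j : Fin n, A (Function.update i s j) = 0

/-- The conditions on an `r`-tensor of side length `n`, with constants `K₁`, `K₂`. -/
structure Tensor.Admissible {r n : ℕ} (A : Tensor r n) (K₁ K₂ : ℝ) : Prop where
  centered : A.IsCentered
  entry_le : ∀ i : Fin r → Fin n, |A i| ≤ K₁ / √(n : ℝ)
  le_sum_sq : K₂ * (n : ℝ) ^ (r - 1) ≤ ∑ i : Fin r → Fin n, A i ^ 2

/-- The multi-index `(i, π₁ i, …, πᵣ₋₁ i)`; the permutations are numbered from zero. -/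
def permIndex {r n : ℕ} (π : Fin (r - 1) → Equiv.Perm (Fin n)) (i : Fin n) : Fin r → Fin n :=
  fun s => if h : (s : ℕ) = 0 then i else π ⟨(s : ℕ) - 1, by have := s.isLt; omega⟩ i

/-- `∑ i, a_{i, π₁ i, …, πᵣ₋₁ i}`. -/
def permSum {r n : ℕ} (A : Tensor r n) (π : Fin (r - 1) → Equiv.Perm (Fin n)) : ℝ :=
  ∑ i : Fin n, A (permIndex π i)

/-- The random permutation `σ` is uniformly distributed on the permutations of `Fin n`. -/
def IsUniformPerm {Ω : Type*} [MeasurableSpace Ω] {n : ℕ} (σ : Ω → Equiv.Perm (Fin n))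
    (P : Measure Ω) : Prop :=
  Measurable σ ∧
    ∀ τ : Equiv.Perm (Fin n), P {ω | σ ω = τ} = ((Nat.factorial n : ℕ) : ENNReal)⁻¹

end TensorCLT

/-! The proof is Stein's method of exchangeable swaps, run on characteristic functions. Composing
with one more uniform permutation turns `permSum` into the symmetric sum W = `diagSum` over r
independent permutations (`expect_permSum`), so that all coordinates play the same role.

The core is the approximate integration by parts E[W f(W)] ≈ v E[f'(W)] with v = `Tensor.scale`,
proved in `SteinTest.norm_expect_diagSum_mul_sub_le`. A random transposition in one coordinate s
replaces the entry x_ii by x_il and changes W by x_il + x_li - x_ii - x_ll. By centering, f(W)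
itself averages out against x_il, and a Taylor expansion leaves g(W) x_il times that increment,
where g = f'. The squares x_il² average to the mean square of the tensor. The x_ii term vanishes by
centering in s, and the other two cross terms are small by centering in a second coordinate t, which
is where r ≥ 2 enters.

Constant and linear f give the mean and variance. Exponential f gives φ' ≈ -v t φ for the
characteristic function, hence closeness to a Gaussian. With κ = K₁/√n the errors nκ³ and κ² tend to
0, while v ≥ K₂ makes the normalization harmless. -/

namespace TensorCLT

open Finset Function
open scoped BigOperators

/-! ### Swapping rows and its effect on the sum -/

section Swap

variable {r n : ℕ}

/-- The entry of `A` whose `s`-th index is the image of `ρ s` under the `s`-th permutation. -/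
def evalAt (A : Tensor r n) (σ : Fin r → Equiv.Perm (Fin n)) (ρ : Fin r → Fin n) : ℝ :=
  A fun s => σ s (ρ s)

/-- The sum `∑ i, a_{σ₁ i, …, σᵣ i}`. -/
def diagSum (A : Tensor r n) (σ : Fin r → Equiv.Perm (Fin n)) : ℝ :=
  ∑ i, evalAt A σ fun _ => i

/-- In each coordinate `s`, exchange the values of the permutation at `ρ s` and at `l s`. -/
def swapRows (ρ l : Fin r → Fin n) (σ : Fin r → Equiv.Perm (Fin n)) :
    Fin r → Equiv.Perm (Fin n) :=
  fun s => σ s * Equiv.swap (ρ s) (l s)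

lemma swapRows_involutive (ρ l : Fin r → Fin n) : Involutive (swapRows ρ l) := by
  intro σ
  funext s
  simp [swapRows, mul_assoc]

lemma expect_swapRows (ρ l : Fin r → Fin n) (F : (Fin r → Equiv.Perm (Fin n)) → ℂ) :
    𝔼 σ, F (swapRows ρ l σ) = 𝔼 σ, F σ :=
  Fintype.expect_bijective _ (swapRows_involutive ρ l).bijective _ _ fun _ => rfl

lemma evalAt_swapRows (A : Tensor r n) (σ : Fin r → Equiv.Perm (Fin n)) (ρ l : Fin r → Fin n) :
    evalAt A (swapRows ρ l σ) ρ = evalAt A σ l := by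
  simp [evalAt, swapRows]

lemma evalAt_swapRows_of_ne (A : Tensor r n) (σ : Fin r → Equiv.Perm (Fin n))
    {ρ l τ : Fin r → Fin n} (h : ∀ s, ρ s = l s ∨ τ s ≠ ρ s ∧ τ s ≠ l s) :
    evalAt A (swapRows ρ l σ) τ = evalAt A σ τ := by
  unfold evalAt swapRows
  congr 1
  funext s
  rcases h s with h | ⟨h1, h2⟩
  · simp [h]
  · simp [Equiv.swap_apply_of_ne_of_ne h1 h2]

lemma sum_evalAt_update {A : Tensor r n} (hA : A.IsCentered)
    (σ : Fin r → Equiv.Perm (Fin n)) (ρ : Fin r → Fin n) (s : Fin r) :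
    ∑ m, evalAt A σ (update ρ s m) = 0 := by
  rw [← hA s fun t => σ t (ρ t)]
  refine Fintype.sum_equiv (σ s) _ _ fun m => ?_
  unfold evalAt
  congr 1
  funext t
  by_cases h : t = s
  · subst h; simp
  · simp [h]

variable {A : Tensor r n} {κ : ℝ}

/-- Only summands whose index is a value of `ρ` or `l` can change: at most 2r of them, each by at
most 2κ. -/
lemma abs_diagSum_swapRows_sub_le (hκ : ∀ i, |A i| ≤ κ) (σ : Fin r → Equiv.Perm (Fin n))
    (ρ l : Fin r → Fin n) :
    |diagSum A (swapRows ρ l σ) - diagSum A σ| ≤ 4 * r * κ := by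
  classical
  set S : Finset (Fin n) := univ.image ρ ∪ univ.image l with hS
  have hcard : (S.card : ℝ) ≤ 2 * r := by
    have : S.card ≤ r + r := (card_union_le _ _).trans
      (add_le_add (card_image_le.trans (by simp)) (card_image_le.trans (by simp)))
    have h2 : (S.card : ℝ) ≤ (r + r : ℕ) := by exact_mod_cast this
    push_cast at h2; linarith
  have h1 : diagSum A (swapRows ρ l σ) - diagSum A σ
      = ∑ i ∈ S, (evalAt A (swapRows ρ l σ) (fun _ => i) - evalAt A σ fun _ => i) := by
    unfold diagSum
    rw [← sum_sub_distrib]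
    symm
    refine sum_subset (subset_univ _) fun i _ hi => ?_
    rw [evalAt_swapRows_of_ne, sub_self]
    intro s
    right
    simp only [hS, mem_union, mem_image, mem_univ, true_and, not_or, not_exists] at hi
    exact ⟨fun h => hi.1 s h.symm, fun h => hi.2 s h.symm⟩
  rcases isEmpty_or_nonempty (Fin r → Fin n) with he | ⟨⟨i₀⟩⟩
  · exact (he.false ρ).elim
  have hκ0 : 0 ≤ κ := (abs_nonneg _).trans (hκ i₀)
  rw [h1]
  calc _ ≤ ∑ i ∈ S, |evalAt A (swapRows ρ l σ) (fun _ => i) - evalAt A σ fun _ => i| :=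
        abs_sum_le_sum_abs _ _
    _ ≤ ∑ i ∈ S, (κ + κ) := sum_le_sum fun i _ =>
        (abs_sub _ _).trans (add_le_add (hκ _) (hκ _))
    _ = S.card * (κ + κ) := by rw [sum_const, nsmul_eq_mul]
    _ ≤ 2 * r * (κ + κ) := by gcongr
    _ = 4 * r * κ := by ring

/-- A single transposition in coordinate `s` touches only the summands `i` and `l`; this exact
increment feeds the Taylor expansion. -/
lemma diagSum_swapRows_update_sub (A : Tensor r n) (σ : Fin r → Equiv.Perm (Fin n)) (s : Fin r)
    (i l : Fin n) :
    diagSum A (swapRows (fun _ => i) (update (fun _ => i) s l) σ) - diagSum A σ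
      = evalAt A σ (update (fun _ => i) s l) + evalAt A σ (update (fun _ => l) s i)
        - evalAt A σ (fun _ => i) - evalAt A σ (fun _ => l) := by
  by_cases hil : i = l
  · subst hil
    have h : update (fun _ : Fin r => i) s i = fun _ => i := update_eq_self _ _
    have h2 : swapRows (fun _ => i) (fun _ => i) σ = σ := by
      funext
      simp [swapRows, ← Equiv.Perm.one_def]
    rw [h, h2]; ring
  have h1 : diagSum A (swapRows (fun _ => i) (update (fun _ => i) s l) σ) - diagSum A σ
      = ∑ k ∈ {i, l}, (evalAt A (swapRows (fun _ => i) (update (fun _ => i) s l) σ) (fun _ => k)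
          - evalAt A σ fun _ => k) := by
    unfold diagSum
    rw [← sum_sub_distrib]
    symm
    refine sum_subset (subset_univ _) fun k _ hk => ?_
    rw [evalAt_swapRows_of_ne, sub_self]
    intro t
    simp only [mem_insert, mem_singleton, not_or] at hk
    by_cases h : t = s
    · subst h; right; simpa using hk
    · left; simp [h]
  have h2 : evalAt A (swapRows (fun _ => i) (update (fun _ => i) s l) σ) (fun _ => l)
      = evalAt A σ (update (fun _ => l) s i) := by
    unfold evalAt swapRows
    congr 1
    funext t
    by_cases h : t = s
    · subst h; simp
    · simp [h]
  rw [h1, sum_pair hil, evalAt_swapRows, h2]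
  ring

lemma expect_evalAt_sq (A : Tensor r n) (σ : Fin r → Equiv.Perm (Fin n)) :
    𝔼 l, (evalAt A σ l : ℂ) ^ 2 = 𝔼 i, (A i : ℂ) ^ 2 :=
  Fintype.expect_equiv (Equiv.piCongrRight σ) _ _ fun _ => rfl

end Swap

/-! ### Comparing averages, with one exceptional index allowed -/

section Averages

variable {ι : Type*} [Fintype ι]

lemma norm_expect_sub_le [Nonempty ι] {F G : ι → ℂ} {c : ℝ} (h : ∀ i, ‖F i - G i‖ ≤ c) :
    ‖𝔼 i, F i - 𝔼 i, G i‖ ≤ c := by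
  rw [← expect_sub_distrib]
  exact (RCLike.norm_expect_le (K := ℂ)).trans (expect_le univ_nonempty fun i _ => h i)

lemma norm_expect_sub_le_add [Nonempty ι] [DecidableEq ι] {F G : ι → ℂ} {c d : ℝ} (j : ι)
    (h : ∀ i, ‖F i - G i‖ ≤ c + if i = j then d else 0) :
    ‖𝔼 i, F i - 𝔼 i, G i‖ ≤ c + d / Fintype.card ι := by
  rw [← expect_sub_distrib]
  refine (RCLike.norm_expect_le (K := ℂ)).trans ((expect_le_expect fun i _ => h i).trans_eq ?_)
  rw [expect_add_distrib, Fintype.expect_const, Fintype.expect_eq_sum_div_card]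
  simp

end Averages

/-- A function `f` with derivative `g` such that `g` is bounded by `M₁` and Lipschitz with
constant `M₂`, in the quantitative form used for Taylor expansions. -/
structure SteinTest (f g : ℝ → ℂ) (M₁ M₂ : ℝ) : Prop where
  norm_le : ∀ x, ‖g x‖ ≤ M₁
  lipschitz : ∀ x y, ‖g y - g x‖ ≤ M₂ * |y - x|
  taylor : ∀ x y, ‖f y - f x - (y - x : ℝ) * g x‖ ≤ M₂ * |y - x| ^ 2

/-! ### Approximate integration by parts -/

section Stein

variable {r n : ℕ} {A : Tensor r n} {κ : ℝ} {f g : ℝ → ℂ} {M₁ M₂ : ℝ}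

lemma SteinTest.nonneg (hg : SteinTest f g M₁ M₂) : 0 ≤ M₁ ∧ 0 ≤ M₂ := by
  refine ⟨(norm_nonneg _).trans (hg.norm_le 0), ?_⟩
  simpa using (norm_nonneg _).trans (hg.lipschitz 0 1)

lemma SteinTest.norm_swapRows_sub_le (hg : SteinTest f g M₁ M₂) (hκ : ∀ i, |A i| ≤ κ)
    (σ : Fin r → Equiv.Perm (Fin n)) (ρ l : Fin r → Fin n) :
    ‖g (diagSum A (swapRows ρ l σ)) - g (diagSum A σ)‖ ≤ M₂ * (4 * r * κ) :=
  (hg.lipschitz _ _).trans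
    (mul_le_mul_of_nonneg_left (abs_diagSum_swapRows_sub_le hκ σ ρ l) hg.nonneg.2)

/-- Replacing the rows `ρ` by uniformly distributed rows. -/
lemma SteinTest.norm_expect_sq_sub_le [NeZero n] (hg : SteinTest f g M₁ M₂)
    (hκ : ∀ i, |A i| ≤ κ) (ρ : Fin r → Fin n) :
    ‖𝔼 σ, g (diagSum A σ) * (evalAt A σ ρ : ℂ) ^ 2
      - (𝔼 i, (A i : ℂ) ^ 2) * 𝔼 σ, g (diagSum A σ)‖ ≤ M₂ * (4 * r * κ) * κ ^ 2 := by
  -- Swapping `ρ` with `l` preserves the uniform law and moves the square to `l`; the only cost is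
  -- the shift of `diagSum` inside `g`. For fixed `σ`, averaging over `l` then runs through the
  -- whole tensor.
  have h1 : 𝔼 σ, g (diagSum A σ) * (evalAt A σ ρ : ℂ) ^ 2
      = 𝔼 l, 𝔼 σ, g (diagSum A (swapRows ρ l σ)) * (evalAt A σ l : ℂ) ^ 2 := by
    rw [← Fintype.expect_const (ι := Fin r → Fin n)
      (𝔼 σ, g (diagSum A σ) * (evalAt A σ ρ : ℂ) ^ 2)]
    refine expect_congr rfl fun l _ => ?_
    rw [← expect_swapRows ρ l]
    simp only [evalAt_swapRows]
  have h2 : (𝔼 i, (A i : ℂ) ^ 2) * 𝔼 σ, g (diagSum A σ)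
      = 𝔼 l, 𝔼 σ, g (diagSum A σ) * (evalAt A σ l : ℂ) ^ 2 := by
    rw [expect_comm, mul_expect]
    refine expect_congr rfl fun σ _ => ?_
    rw [← mul_expect, expect_evalAt_sq, mul_comm]
  rw [h1, h2]
  refine norm_expect_sub_le fun l => norm_expect_sub_le fun σ => ?_
  rw [← sub_mul, norm_mul]
  refine mul_le_mul (hg.norm_swapRows_sub_le hκ σ ρ l) ?_ (norm_nonneg _)
    ((norm_nonneg _).trans (hg.norm_swapRows_sub_le hκ σ ρ l))
  rw [norm_pow, Complex.norm_real]
  exact pow_le_pow_left₀ (norm_nonneg _) (hκ _) 2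

/-- A centered entry is asymptotically uncorrelated with a factor `Y` which is insensitive to
exchanging rows in a coordinate `t`. -/
lemma SteinTest.norm_expect_mul_le [NeZero n] (hg : SteinTest f g M₁ M₂) (hA : A.IsCentered)
    (hκ : ∀ i, |A i| ≤ κ) (ρ : Fin r → Fin n) (t : Fin r) (l : Fin n)
    (Y : (Fin r → Equiv.Perm (Fin n)) → ℝ) (hY : ∀ σ, |Y σ| ≤ κ)
    (hYs : ∀ m, m ≠ l → ∀ σ, Y (swapRows ρ (update ρ t m) σ) = Y σ) :
    ‖𝔼 σ, g (diagSum A σ) * evalAt A σ ρ * Y σ‖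
      ≤ M₂ * (4 * r * κ) * κ ^ 2 + 2 * M₁ * κ ^ 2 / n := by
  have hκ0 : 0 ≤ κ := (abs_nonneg _).trans (hκ ρ)
  have h1 : 𝔼 σ, g (diagSum A σ) * evalAt A σ ρ * Y σ
      = 𝔼 m : Fin n, 𝔼 σ, g (diagSum A (swapRows ρ (update ρ t m) σ))
        * evalAt A σ (update ρ t m) * Y (swapRows ρ (update ρ t m) σ) := by
    rw [← Fintype.expect_const (ι := Fin n) (𝔼 σ, g (diagSum A σ) * evalAt A σ ρ * Y σ)]
    refine expect_congr rfl fun m _ => ?_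
    rw [← expect_swapRows ρ (update ρ t m)]
    simp only [evalAt_swapRows]
  -- Once `g` and `Y` are left unswapped, centering in coordinate `t` kills the average for every
  -- `σ`.
  have h2 : 𝔼 m : Fin n, 𝔼 σ, g (diagSum A σ) * evalAt A σ (update ρ t m) * Y σ = 0 := by
    rw [expect_comm]
    refine expect_eq_zero fun σ _ => ?_
    rw [← expect_mul, ← mul_expect, expect_univ, ← Complex.ofReal_sum,
      sum_evalAt_update hA]
    simp
  rw [h1, ← sub_zero (𝔼 m : Fin n, _), ← h2]
  have hcard : (n : ℝ) = Fintype.card (Fin n) := by simp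
  rw [hcard]
  refine norm_expect_sub_le_add l fun m => ?_
  refine norm_expect_sub_le fun σ => ?_
  have hx : ‖(evalAt A σ (update ρ t m) : ℂ)‖ ≤ κ := by
    rw [Complex.norm_real]; exact hκ _
  have hy : ∀ σ, ‖(Y σ : ℂ)‖ ≤ κ := fun σ => by
    rw [Complex.norm_real]; exact hY _
  have hD := hg.norm_swapRows_sub_le hκ σ ρ (update ρ t m)
  have hM2 : 0 ≤ M₂ * (4 * r * κ) := (norm_nonneg _).trans hD
  -- Only at `m = l` may `Y` change; the crude bound 2M₁κ² suffices there, as this index has weight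
  -- 1/n.
  by_cases hm : m = l
  · simp only [hm, if_true]
    have hb : ∀ x σ, ‖g x * (evalAt A σ (update ρ t l) : ℂ) * (Y (σ) : ℂ)‖ ≤ M₁ * κ * κ := by
      intro x σ
      rw [norm_mul, norm_mul, Complex.norm_real]
      have := hg.nonneg.1
      gcongr
      · exact hg.norm_le _
      · exact hκ _
      · exact hy _
    have hb' : ‖g (diagSum A (swapRows ρ (update ρ t l) σ)) * (evalAt A σ (update ρ t l) : ℂ)
        * (Y (swapRows ρ (update ρ t l) σ) : ℂ)‖ ≤ M₁ * κ * κ := by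
      rw [norm_mul, norm_mul, Complex.norm_real]
      have := hg.nonneg.1
      gcongr
      · exact hg.norm_le _
      · exact hκ _
      · exact hy _
    have := (norm_sub_le _ _).trans (add_le_add hb' (hb (diagSum A σ) σ))
    have h3 : 0 ≤ M₂ * (4 * r * κ) * κ ^ 2 := by positivity
    refine this.trans ?_
    nlinarith
  · simp only [hm, if_false, add_zero]
    rw [hYs m hm, ← sub_mul, ← sub_mul, norm_mul, norm_mul, pow_two, ← mul_assoc]
    gcongr
    exact hy _

/-- Approximate integration by parts for the sum `diagSum A` over independent permutations. -/
theorem SteinTest.norm_expect_diagSum_mul_sub_le [NeZero n] (hg : SteinTest f g M₁ M₂)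
    (hr : 2 ≤ r) (hA : A.IsCentered) (hκ : ∀ i, |A i| ≤ κ) :
    ‖𝔼 σ, (diagSum A σ : ℂ) * f (diagSum A σ)
        - (n * 𝔼 i, (A i : ℂ) ^ 2) * 𝔼 σ, g (diagSum A σ)‖
      ≤ M₂ * (n * κ ^ 3 * ((4 * r) ^ 2 + 3 * (4 * r))) + M₁ * (6 * κ ^ 2) := by
  -- Coordinate `s` carries the transposition; `t` is kept for decorrelating the cross terms.
  obtain ⟨s, t, hst⟩ : ∃ s t : Fin r, s ≠ t := ⟨⟨0, by omega⟩, ⟨1, by omega⟩, by simp⟩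
  have hn : (0 : ℝ) < n := by exact_mod_cast NeZero.pos n
  have hκ0 : 0 ≤ κ := (abs_nonneg _).trans (hκ fun _ => 0)
  obtain ⟨hM1, hM2⟩ := hg.nonneg
  set x : (Fin r → Equiv.Perm (Fin n)) → Fin n → Fin n → ℝ :=
    fun σ i l => evalAt A σ (update (fun _ => i) s l) with hx
  have hxd : ∀ σ i, x σ i i = evalAt A σ fun _ => i := fun σ i => by
    simp only [hx]; rw [update_eq_self]
  have hxκ : ∀ σ i l, |x σ i l| ≤ κ := fun σ i l => hκ _
  have hxc : ∀ σ i, ∑ l, x σ i l = 0 := fun σ i => sum_evalAt_update hA σ _ s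
  have hxc' : ∀ σ i, 𝔼 l, (x σ i l : ℂ) = 0 := fun σ i => by
    rw [expect_univ, ← Complex.ofReal_sum, hxc]; simp
  let T : Fin n → Fin n → (Fin r → Equiv.Perm (Fin n)) → (Fin r → Equiv.Perm (Fin n)) :=
    fun i l => swapRows (fun _ => i) (update (fun _ => i) s l)
  have hT : ∀ i l σ, diagSum A (T i l σ) - diagSum A σ
      = x σ i l + x σ l i - x σ i i - x σ l l := fun i l σ => by
    rw [hxd, hxd]; exact diagSum_swapRows_update_sub A σ s i l
  -- a transposition of a single coordinate
  have hstep1 : ∀ i, 𝔼 σ, (x σ i i : ℂ) * f (diagSum A σ)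
      = 𝔼 l, 𝔼 σ, (x σ i l : ℂ) * (f (diagSum A (T i l σ)) - f (diagSum A σ)) := by
    intro i
    have e1 : 𝔼 σ, (x σ i i : ℂ) * f (diagSum A σ)
        = 𝔼 l, 𝔼 σ, (x σ i l : ℂ) * f (diagSum A (T i l σ)) := by
      rw [← Fintype.expect_const (ι := Fin n) (𝔼 σ, (x σ i i : ℂ) * f (diagSum A σ))]
      refine expect_congr rfl fun l _ => ?_
      rw [← expect_swapRows (fun _ => i) (update (fun _ => i) s l)]
      simp only [hxd, evalAt_swapRows]
      rfl
    have e2 : 𝔼 l, 𝔼 σ, (x σ i l : ℂ) * f (diagSum A σ) = 0 := by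
      rw [expect_comm]
      refine expect_eq_zero fun σ _ => ?_
      rw [← expect_mul, hxc', zero_mul]
    rw [e1, ← sub_zero (𝔼 l, _), ← e2, ← expect_sub_distrib]
    refine expect_congr rfl fun l _ => ?_
    rw [← expect_sub_distrib]
    exact expect_congr rfl fun σ _ => by ring
  -- first order Taylor expansion
  have htaylor : ∀ i, ‖𝔼 σ, (x σ i i : ℂ) * f (diagSum A σ)
      - 𝔼 l, 𝔼 σ, g (diagSum A σ) * x σ i l * (x σ i l + x σ l i - x σ i i - x σ l l : ℝ)‖
      ≤ κ * (M₂ * (4 * r * κ) ^ 2) := by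
    intro i
    rw [hstep1]
    refine norm_expect_sub_le fun l => norm_expect_sub_le fun σ => ?_
    rw [← hT]
    have : (x σ i l : ℂ) * (f (diagSum A (T i l σ)) - f (diagSum A σ))
        - g (diagSum A σ) * x σ i l * (diagSum A (T i l σ) - diagSum A σ : ℝ)
        = x σ i l * (f (diagSum A (T i l σ)) - f (diagSum A σ)
          - (diagSum A (T i l σ) - diagSum A σ : ℝ) * g (diagSum A σ)) := by ring
    rw [this, norm_mul, Complex.norm_real]
    refine mul_le_mul (hxκ _ _ _) ((hg.taylor _ _).trans ?_) (norm_nonneg _) hκ0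
    gcongr
    exact abs_diagSum_swapRows_sub_le hκ σ _ _
  -- the quadratic terms
  set V : ℂ := (𝔼 i, (A i : ℂ) ^ 2) * 𝔼 σ, g (diagSum A σ) with hV
  set E : ℝ := M₂ * (4 * r * κ) * κ ^ 2 with hE
  have hE0 : 0 ≤ E := by positivity
  have hsq : ∀ i l, ‖𝔼 σ, g (diagSum A σ) * x σ i l * x σ i l - V‖ ≤ E := by
    intro i l
    refine le_trans (le_of_eq ?_) (hg.norm_expect_sq_sub_le hκ (update (fun _ => i) s l))
    simp only [hx, hV, pow_two, mul_assoc]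
  have hcross : ∀ i l (y : (Fin r → Equiv.Perm (Fin n)) → ℝ), (∀ σ, |y σ| ≤ κ) →
      (i ≠ l → ∀ m, m ≠ l → ∀ σ, y (swapRows (update (fun _ => i) s l)
        (update (update (fun _ => i) s l) t m) σ) = y σ) →
      ‖𝔼 σ, g (diagSum A σ) * x σ i l * y σ‖
        ≤ E + 2 * M₁ * κ ^ 2 / n + if l = i then M₁ * κ ^ 2 else 0 := by
    intro i l y hy hys
    have hp : 0 ≤ 2 * M₁ * κ ^ 2 / n := by positivity
    by_cases hil : l = i
    · rw [if_pos hil]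
      have : ‖𝔼 σ, g (diagSum A σ) * x σ i l * y σ‖ ≤ M₁ * κ ^ 2 := by
        refine (RCLike.norm_expect_le (K := ℂ)).trans
          (expect_le univ_nonempty fun σ _ => ?_)
        rw [norm_mul, norm_mul, Complex.norm_real, Complex.norm_real, pow_two, ← mul_assoc]
        gcongr
        · exact hg.norm_le _
        · exact hxκ _ _ _
        · exact hy _
      linarith
    · rw [if_neg hil, add_zero]
      exact hg.norm_expect_mul_le hA hκ _ t l y hy (hys (Ne.symm hil))
  have hc1 : ∀ i l, ‖𝔼 σ, g (diagSum A σ) * x σ i l * x σ l i‖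
      ≤ E + 2 * M₁ * κ ^ 2 / n + if l = i then M₁ * κ ^ 2 else 0 := by
    intro i l
    refine hcross i l _ (fun σ => hxκ _ _ _) fun hil m hm σ => ?_
    refine evalAt_swapRows_of_ne A σ fun u => ?_
    by_cases hu : u = t
    · subst hu; right; simp [hst.symm, hm.symm, hil.symm]
    · left; simp [hu]
  have hc2 : ∀ i l, ‖𝔼 σ, g (diagSum A σ) * x σ i l * x σ l l‖
      ≤ E + 2 * M₁ * κ ^ 2 / n + if l = i then M₁ * κ ^ 2 else 0 := by
    intro i l
    refine hcross i l _ (fun σ => hxκ _ _ _) fun hil m hm σ => ?_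
    refine evalAt_swapRows_of_ne A σ fun u => ?_
    by_cases hu : u = t
    · subst hu; right; simp [hst.symm, hm.symm, hil.symm]
    · left; simp [hu]
  -- `hcross` is not suited to this term, since a swap in `t` would also move `x σ i i`. But that
  -- factor is independent of `l`, so centering in `s` gives exactly 0.
  have hdiag : ∀ i, 𝔼 l, 𝔼 σ, g (diagSum A σ) * x σ i l * x σ i i = 0 := by
    intro i
    rw [expect_comm]
    refine expect_eq_zero fun σ _ => ?_
    rw [← expect_mul, ← mul_expect, hxc']
    simp
  have hquad : ∀ i, ‖𝔼 l, 𝔼 σ, g (diagSum A σ) * x σ i l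
      * (x σ i l + x σ l i - x σ i i - x σ l l : ℝ) - V‖ ≤ 3 * E + 6 * M₁ * κ ^ 2 / n := by
    intro i
    have e1 : 𝔼 l, 𝔼 σ, g (diagSum A σ) * x σ i l
        * (x σ i l + x σ l i - x σ i i - x σ l l : ℝ)
        = 𝔼 l, (𝔼 σ, g (diagSum A σ) * x σ i l * x σ i l
          + 𝔼 σ, g (diagSum A σ) * x σ i l * x σ l i
          - 𝔼 σ, g (diagSum A σ) * x σ i l * x σ l l) := by
      rw [← sub_zero (𝔼 l, (_ - _)), ← hdiag i, ← expect_sub_distrib]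
      refine expect_congr rfl fun l _ => ?_
      rw [← expect_add_distrib, ← expect_sub_distrib, ← expect_sub_distrib]
      refine expect_congr rfl fun σ _ => ?_
      push_cast; ring
    rw [e1, ← Fintype.expect_const (ι := Fin n) V]
    -- The 6 is 4 from the two cross terms plus 2 from the exceptional index `l = i`, which has
    -- weight 1/n.
    have e2 : 3 * E + 6 * M₁ * κ ^ 2 / n
        = 3 * E + 4 * M₁ * κ ^ 2 / n + 2 * M₁ * κ ^ 2 / Fintype.card (Fin n) := by
      rw [Fintype.card_fin]; ring
    rw [e2]
    refine norm_expect_sub_le_add i fun l => ?_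
    have h3 := (norm_sub_le _ _).trans (add_le_add ((norm_add_le _ _).trans
      (add_le_add (hsq i l) (hc1 i l))) (hc2 i l))
    refine le_trans (le_of_eq ?_) (h3.trans (le_of_eq ?_))
    · congr 1; ring
    · split_ifs <;> ring
  have hfin : ∀ i, ‖𝔼 σ, (x σ i i : ℂ) * f (diagSum A σ) - V‖
      ≤ κ * (M₂ * (4 * r * κ) ^ 2) + (3 * E + 6 * M₁ * κ ^ 2 / n) := fun i =>
    (norm_sub_le_norm_sub_add_norm_sub _ _ _).trans (add_le_add (htaylor i) (hquad i))
  have hsum : 𝔼 σ, (diagSum A σ : ℂ) * f (diagSum A σ)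
      - (n * 𝔼 i, (A i : ℂ) ^ 2) * 𝔼 σ, g (diagSum A σ)
      = ∑ i, (𝔼 σ, (x σ i i : ℂ) * f (diagSum A σ) - V) := by
    rw [sum_sub_distrib, ← expect_sum_comm]
    congr 1
    · refine expect_congr rfl fun σ _ => ?_
      rw [← sum_mul, diagSum, Complex.ofReal_sum]
      simp only [hxd]
    · simp [hV]; ring
  rw [hsum]
  refine (norm_sum_le _ _).trans ((sum_le_sum fun i _ => hfin i).trans_eq ?_)
  simp only [sum_const, card_univ, Fintype.card_fin, nsmul_eq_mul, hE]
  field_simp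
  ring

end Stein

/-! ### Test functions and the Gaussian differential equation -/

lemma hasDerivAt_ofReal (x : ℝ) : HasDerivAt (fun x : ℝ => (x : ℂ)) 1 x := by
  simpa using (hasDerivAt_id x).ofReal_comp

lemma SteinTest.of_hasDerivAt {f g : ℝ → ℂ} {M₁ M₂ : ℝ} (hf : ∀ x, HasDerivAt f (g x) x)
    (h₁ : ∀ x, ‖g x‖ ≤ M₁) (hM₂ : 0 ≤ M₂) (h₂ : ∀ x y, ‖g y - g x‖ ≤ M₂ * |y - x|) :
    SteinTest f g M₁ M₂ where
  norm_le := h₁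
  lipschitz := h₂
  taylor x y := by
    have key := Convex.norm_image_sub_le_of_norm_hasDerivWithin_le (𝕜 := ℝ)
      (f := fun z : ℝ => f z - (z : ℂ) * g x) (f' := fun z => g z - g x) (s := Set.uIcc x y)
      (x := x) (y := y) (C := M₂ * |y - x|)
      (fun z _ => by
        have := (hf z).fun_sub ((hasDerivAt_ofReal z).mul_const (g x))
        rw [one_mul] at this
        exact this.hasDerivWithinAt)
      (fun z hz => (h₂ x z).trans
        (mul_le_mul_of_nonneg_left (Set.abs_sub_left_of_mem_uIcc hz) hM₂))
      (convex_uIcc x y) Set.left_mem_uIcc Set.right_mem_uIcc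
    rw [Real.norm_eq_abs] at key
    refine le_trans (le_of_eq ?_) (key.trans (le_of_eq (by ring)))
    congr 1
    push_cast
    ring

lemma steinTest_const : SteinTest (fun _ => 1) (fun _ => 0) 0 0 :=
  .of_hasDerivAt (fun _ => hasDerivAt_const _ _) (by simp) le_rfl (by simp)

/-- Since M₂ = 0, the nκ³ error disappears and the second moment is known up to 6κ². -/
lemma steinTest_id : SteinTest (fun x => (x : ℂ)) (fun _ => 1) 1 0 :=
  .of_hasDerivAt hasDerivAt_ofReal (by simp) le_rfl (by simp)

lemma norm_exp_mul_mul_I (t x : ℝ) : ‖Complex.exp (t * x * Complex.I)‖ = 1 := by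
  rw [← Complex.ofReal_mul, Complex.norm_exp_ofReal_mul_I]

lemma hasDerivAt_exp_mul_I (t x : ℝ) :
    HasDerivAt (fun x : ℝ => Complex.exp (t * x * Complex.I))
      (t * Complex.I * Complex.exp (t * x * Complex.I)) x := by
  have h := (((hasDerivAt_ofReal x).const_mul (t : ℂ)).mul_const
    Complex.I).cexp
  simpa [mul_comm] using h

lemma steinTest_exp (t : ℝ) : SteinTest (fun x => Complex.exp (t * x * Complex.I))
    (fun x => t * Complex.I * Complex.exp (t * x * Complex.I)) |t| (t ^ 2) := by
  refine .of_hasDerivAt (hasDerivAt_exp_mul_I t) (fun x => ?_) (sq_nonneg t) fun x y => ?_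
  · rw [norm_mul, norm_exp_mul_mul_I]; simp
  · refine Convex.norm_image_sub_le_of_norm_hasDerivWithin_le (𝕜 := ℝ) (s := Set.univ)
      (f' := fun x : ℝ => t * Complex.I * (t * Complex.I * Complex.exp (t * x * Complex.I)))
      (fun z _ => ((hasDerivAt_exp_mul_I t z).const_mul _).hasDerivWithinAt)
      (fun z _ => ?_) convex_univ (Set.mem_univ _) (Set.mem_univ _)
    rw [norm_mul _ (_ * _), norm_mul _ (Complex.exp _), norm_exp_mul_mul_I]
    simp [← pow_two]

/-- A function which nearly satisfies the differential equation `φ' = -v t φ` with `φ 0 = 1` is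
close to the characteristic function of a centered Gaussian. -/
lemma norm_sub_exp_le_of_hasDerivAt {φ φ' : ℝ → ℂ} {v a b : ℝ} (hv : 0 ≤ v) (ha : 0 ≤ a)
    (hb : 0 ≤ b) (hφ : ∀ t, HasDerivAt φ (φ' t) t) (h0 : φ 0 = 1)
    (h : ∀ t, ‖φ' t + v * t * φ t‖ ≤ t ^ 2 * a + |t| * b) (t : ℝ) :
    ‖φ t - Complex.exp (-(v * t ^ 2 / 2))‖ ≤ |t| * (t ^ 2 * a + |t| * b) := by
  -- Integrating factor: its maximum on the interval is attained at `t` and cancels when it is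
  -- divided out at the end.
  have hd : ∀ u, HasDerivAt (fun u : ℝ => φ u * Complex.exp (v * (u : ℂ) ^ 2 / 2))
      ((φ' u + v * u * φ u) * Complex.exp (v * (u : ℂ) ^ 2 / 2)) u := by
    intro u
    have h1 : HasDerivAt (fun u : ℝ => (v : ℂ) * (u : ℂ) ^ 2 / 2) ((v : ℂ) * u) u := by
      have := (((hasDerivAt_ofReal u).fun_pow 2).const_mul (v : ℂ)).div_const 2
      convert! this using 1
      simp
      ring
    convert! (hφ u).mul h1.cexp using 1
    ring
  have hn : ∀ u : ℝ, ‖Complex.exp (v * (u : ℂ) ^ 2 / 2)‖ = Real.exp (v * u ^ 2 / 2) := by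
    intro u
    have : (v * (u : ℂ) ^ 2 / 2 : ℂ) = ((v * u ^ 2 / 2 : ℝ) : ℂ) := by push_cast; rfl
    rw [this, Complex.norm_exp_ofReal]
  have key := Convex.norm_image_sub_le_of_norm_hasDerivWithin_le (𝕜 := ℝ)
    (x := 0) (y := t) (s := Set.uIcc 0 t)
    (C := (t ^ 2 * a + |t| * b) * Real.exp (v * t ^ 2 / 2))
    (fun u _ => (hd u).hasDerivWithinAt)
    (fun u hu => by
      have hu' : |u| ≤ |t| := by simpa using Set.abs_sub_left_of_mem_uIcc hu
      have hu2 : u ^ 2 ≤ t ^ 2 := sq_le_sq.2 hu'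
      rw [norm_mul, hn]
      refine mul_le_mul ((h u).trans ?_) ?_ (Real.exp_pos _).le (by positivity)
      · gcongr
      · gcongr)
    (convex_uIcc 0 t) Set.left_mem_uIcc Set.right_mem_uIcc
  have e : φ t - Complex.exp (-(v * t ^ 2 / 2))
      = (φ t * Complex.exp (v * (t : ℂ) ^ 2 / 2) - φ 0 * Complex.exp (v * ((0 : ℝ) : ℂ) ^ 2 / 2))
        * Complex.exp (-(v * t ^ 2 / 2)) := by
    rw [sub_mul, mul_assoc, ← Complex.exp_add, h0]
    simp
  rw [e, norm_mul]
  have hn' : ‖Complex.exp (-(v * (t : ℂ) ^ 2 / 2))‖ = (Real.exp (v * t ^ 2 / 2))⁻¹ := by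
    rw [Complex.exp_neg, norm_inv, hn]
  rw [hn', ← div_eq_mul_inv, div_le_iff₀ (Real.exp_pos _)]
  refine key.trans (le_of_eq ?_)
  rw [sub_zero, Real.norm_eq_abs]
  ring

/-! ### Moments and characteristic function of the symmetric sum -/

section CharFun

variable {r n : ℕ}

/-- The asymptotic variance `n^{-(r-1)} ∑ aᵢ²` of the sum `diagSum A`. -/
noncomputable def Tensor.scale (A : Tensor r n) : ℝ := n * 𝔼 i, A i ^ 2

lemma Tensor.ofReal_scale (A : Tensor r n) :
    (A.scale : ℂ) = n * 𝔼 i, (A i : ℂ) ^ 2 := by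
  simp only [Tensor.scale, Fintype.expect_eq_sum_div_card]
  push_cast
  rfl

lemma Tensor.scale_nonneg (A : Tensor r n) : 0 ≤ A.scale := by
  unfold Tensor.scale
  have : 0 ≤ 𝔼 i, A i ^ 2 := expect_nonneg fun i _ => sq_nonneg _
  positivity

variable [NeZero n] {A : Tensor r n} {κ : ℝ}

lemma expect_diagSum (hr : 2 ≤ r) (hA : A.IsCentered) (hκ : ∀ i, |A i| ≤ κ) :
    𝔼 σ, diagSum A σ = 0 := by
  have h := steinTest_const.norm_expect_diagSum_mul_sub_le hr hA hκ
  simp only [mul_one, expect_const_zero, mul_zero, sub_zero, zero_mul, add_zero,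
    norm_le_zero_iff] at h
  have h2 : ((𝔼 σ, diagSum A σ : ℝ) : ℂ) = 𝔼 σ, (diagSum A σ : ℂ) := by
    simp only [Fintype.expect_eq_sum_div_card]
    push_cast
    rfl
  exact_mod_cast h2.trans h

lemma abs_expect_diagSum_sq_sub_le (hr : 2 ≤ r) (hA : A.IsCentered) (hκ : ∀ i, |A i| ≤ κ) :
    |𝔼 σ, diagSum A σ ^ 2 - A.scale| ≤ 6 * κ ^ 2 := by
  have h := steinTest_id.norm_expect_diagSum_mul_sub_le hr hA hκ
  rw [← Tensor.ofReal_scale] at h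
  have h2 : ((𝔼 σ, diagSum A σ ^ 2 - A.scale : ℝ) : ℂ)
      = 𝔼 σ, (diagSum A σ : ℂ) * diagSum A σ - A.scale * 𝔼 _σ : Fin r → Equiv.Perm (Fin n), 1 := by
    rw [Fintype.expect_const]
    simp only [Fintype.expect_eq_sum_div_card, pow_two]
    push_cast
    ring
  rw [← h2, Complex.norm_real, Real.norm_eq_abs] at h
  simpa using h

theorem norm_expect_exp_diagSum_sub_le (hr : 2 ≤ r) (hA : A.IsCentered) (hκ : ∀ i, |A i| ≤ κ)
    (t : ℝ) :
    ‖𝔼 σ, Complex.exp (t * diagSum A σ * Complex.I) - Complex.exp (-(A.scale * t ^ 2 / 2))‖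
      ≤ |t| * (t ^ 2 * (n * κ ^ 3 * ((4 * r) ^ 2 + 3 * (4 * r))) + |t| * (6 * κ ^ 2)) := by
  have hκ0 : 0 ≤ κ := (abs_nonneg _).trans (hκ fun _ => 0)
  refine norm_sub_exp_le_of_hasDerivAt
    (φ := fun t => 𝔼 σ, Complex.exp (t * diagSum A σ * Complex.I))
    (φ' := fun t => Complex.I *
      𝔼 σ, (diagSum A σ : ℂ) * Complex.exp (t * diagSum A σ * Complex.I))
    A.scale_nonneg (by positivity) (by positivity) (fun u => ?_) (by simp) (fun u => ?_) t
  · simp only [Fintype.expect_eq_sum_div_card, ← mul_div_assoc, mul_sum]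
    refine (HasDerivAt.fun_sum fun σ _ => ?_).div_const _
    have := hasDerivAt_exp_mul_I (diagSum A σ) u
    convert! this using 1
    · ext x; ring_nf
    · ring_nf
  · have h := (steinTest_exp u).norm_expect_diagSum_mul_sub_le hr hA hκ
    rw [← Tensor.ofReal_scale, ← mul_expect] at h
    refine le_trans (le_of_eq ?_) h
    set p := 𝔼 σ, (diagSum A σ : ℂ) * Complex.exp (u * diagSum A σ * Complex.I)
    set q := 𝔼 σ, Complex.exp (u * diagSum A σ * Complex.I)
    have : Complex.I * p + A.scale * u * q
        = Complex.I * (p - A.scale * (u * Complex.I * q)) := by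
      linear_combination ((A.scale : ℂ) * u * q) * Complex.I_mul_I
    rw [this, norm_mul, Complex.norm_I, one_mul]

end CharFun

lemma diagSum_cons {k n : ℕ} (A : Tensor (k + 1) n) (τ : Equiv.Perm (Fin n))
    (p : Fin k → Equiv.Perm (Fin n)) :
    diagSum A (Fin.cons τ fun s => p s * τ) = permSum A p := by
  unfold diagSum permSum evalAt
  refine Fintype.sum_equiv τ _ _ fun i => ?_
  congr 1
  funext s
  refine Fin.cases ?_ (fun s => ?_) s
  · simp [permIndex]
  · simp [permIndex]

/-- Right composition with a common permutation only reorders the summands, and (τ, p) ↦ (τ, p₁τ, …)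
is a bijection onto r-tuples. -/
lemma expect_permSum {r n : ℕ} (hr : r ≠ 0) (A : Tensor r n) (F : ℝ → ℂ) :
    𝔼 p, F (permSum A p) = 𝔼 σ, F (diagSum A σ) := by
  obtain ⟨k, rfl⟩ := Nat.exists_eq_succ_of_ne_zero hr
  have hbij : Bijective fun q : Equiv.Perm (Fin n) × (Fin k → Equiv.Perm (Fin n)) =>
      (Fin.cons q.1 fun s => q.2 s * q.1 : Fin (k + 1) → Equiv.Perm (Fin n)) := by
    refine bijective_iff_has_inverse.2 ⟨fun σ => (σ 0, fun s => σ s.succ * (σ 0)⁻¹), ?_, ?_⟩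
    · rintro ⟨τ, p⟩
      simp
    · intro σ
      funext s
      refine Fin.cases ?_ (fun s => ?_) s <;> simp
  rw [← Fintype.expect_bijective _ hbij (fun q => F (permSum A q.2)) _
    fun q => by rw [diagSum_cons], ← univ_product_univ, expect_product]
  exact (Fintype.expect_const _).symm

/-! ### From averages over permutations to the given probability space -/

section Transfer

variable {Ω : Type*} [MeasurableSpace Ω] {P : Measure Ω}

instance instMeasurableSingletonClassPerm (n : ℕ) :
    MeasurableSingletonClass (Equiv.Perm (Fin n)) := ⟨fun _ => trivial⟩

lemma integral_eq_expect [IsProbabilityMeasure P] {m n : ℕ} {π : Fin m → Ω → Equiv.Perm (Fin n)}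
    (hunif : ∀ s, IsUniformPerm (π s) P) (hindep : iIndepFun π P)
    (F : (Fin m → Equiv.Perm (Fin n)) → ℂ) :
    ∫ ω, F (fun s => π s ω) ∂P = 𝔼 p, F p := by
  have hm : Measurable fun ω s => π s ω := measurable_pi_lambda _ fun s => (hunif s).1
  have hsing : ∀ p, (P.map fun ω s => π s ω).real {p}
      = (Fintype.card (Fin m → Equiv.Perm (Fin n)) : ℝ)⁻¹ := by
    intro p
    have h1 := hindep.measure_inter_preimage_eq_mul univ (sets := fun s => {p s})
      fun s _ => measurableSet_singleton _
    have h2 : (⋂ s ∈ (univ : Finset (Fin m)), π s ⁻¹' {p s})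
        = (fun ω s => π s ω) ⁻¹' {p} := by
      ext ω
      simp [funext_iff]
    have h3 : ∀ s, P (π s ⁻¹' {p s}) = ((Nat.factorial n : ℕ) : ENNReal)⁻¹ := fun s =>
      (hunif s).2 (p s)
    rw [h2] at h1
    rw [measureReal_def, Measure.map_apply hm (measurableSet_singleton _), h1]
    simp [h3, Fintype.card_perm]
  rw [← integral_map (f := F) hm.aemeasurable (measurable_of_countable F).aestronglyMeasurable]
  have := Measure.isProbabilityMeasure_map (μ := P) hm.aemeasurable
  rw [integral_fintype .of_finite, Fintype.expect_eq_sum_div_card]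
  simp only [hsing]
  rw [← smul_sum, div_eq_inv_mul, Complex.real_smul]
  push_cast
  rfl

variable {r n : ℕ} {π : Fin (r - 1) → Ω → Equiv.Perm (Fin n)} {A : Tensor r n} {C : Ω → ℝ}

lemma measurable_permSum (hunif : ∀ s, IsUniformPerm (π s) P)
    (hC : ∀ ω, C ω = permSum A fun s => π s ω) : Measurable C := by
  have hm : Measurable fun ω s => π s ω := measurable_pi_lambda _ fun s => (hunif s).1
  rw [funext hC]
  exact (measurable_of_countable (permSum A)).comp hm

variable [IsProbabilityMeasure P]

lemma memLp_permSum (hunif : ∀ s, IsUniformPerm (π s) P)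
    (hC : ∀ ω, C ω = permSum A fun s => π s ω) : MemLp C 2 P := by
  refine MemLp.of_bound (measurable_permSum hunif hC).aestronglyMeasurable
    (∑ p, ‖permSum A p‖) (ae_of_all _ fun ω => ?_)
  rw [hC]
  exact single_le_sum (f := fun p => ‖permSum A p‖) (fun _ _ => norm_nonneg _) (mem_univ _)

lemma integral_comp_permSum (hr : r ≠ 0) (hunif : ∀ s, IsUniformPerm (π s) P)
    (hindep : iIndepFun π P) (hC : ∀ ω, C ω = permSum A fun s => π s ω) (F : ℝ → ℂ) :
    ∫ ω, F (C ω) ∂P = 𝔼 σ, F (diagSum A σ) := by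
  simp only [hC]
  rw [integral_eq_expect hunif hindep fun p => F (permSum A p), expect_permSum hr]

lemma integral_comp_permSum_real (hr : r ≠ 0) (hunif : ∀ s, IsUniformPerm (π s) P)
    (hindep : iIndepFun π P) (hC : ∀ ω, C ω = permSum A fun s => π s ω) (F : ℝ → ℝ) :
    ∫ ω, F (C ω) ∂P = 𝔼 σ, F (diagSum A σ) := by
  have h := integral_comp_permSum hr hunif hindep hC fun x => (F x : ℂ)
  rw [integral_complex_ofReal] at h
  have h2 : ((𝔼 σ, F (diagSum A σ) : ℝ) : ℂ) = 𝔼 σ, (F (diagSum A σ) : ℂ) := by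
    simp only [Fintype.expect_eq_sum_div_card]
    push_cast
    rfl
  exact_mod_cast h.trans h2.symm

lemma abs_variance_sub_scale_le [NeZero n] {κ : ℝ} (hr : 2 ≤ r) (hA : A.IsCentered)
    (hκ : ∀ i, |A i| ≤ κ) (hunif : ∀ s, IsUniformPerm (π s) P)
    (hindep : iIndepFun π P) (hC : ∀ ω, C ω = permSum A fun s => π s ω) :
    |variance C P - A.scale| ≤ 6 * κ ^ 2 := by
  have hr' : r ≠ 0 := by omega
  rw [variance_eq_sub (memLp_permSum hunif hC)]
  have h1 := integral_comp_permSum_real hr' hunif hindep hC fun x => x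
  have h2 := integral_comp_permSum_real hr' hunif hindep hC fun x => x ^ 2
  rw [expect_diagSum hr hA hκ] at h1
  have h3 := abs_expect_diagSum_sq_sub_le hr hA hκ
  rw [← h2] at h3
  simpa [h1] using h3

lemma norm_charFun_sub_le [NeZero n] {κ : ℝ} (hr : 2 ≤ r) (hA : A.IsCentered)
    (hκ : ∀ i, |A i| ≤ κ) (hunif : ∀ s, IsUniformPerm (π s) P)
    (hindep : iIndepFun π P) (hC : ∀ ω, C ω = permSum A fun s => π s ω) (w t : ℝ) :
    ‖charFun (P.map fun ω => C ω / w) t - Complex.exp (-(A.scale * (t / w : ℝ) ^ 2 / 2))‖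
      ≤ |t / w| * ((t / w) ^ 2 * (n * κ ^ 3 * ((4 * r) ^ 2 + 3 * (4 * r)))
        + |t / w| * (6 * κ ^ 2)) := by
  have hm : Measurable fun ω => C ω / w := (measurable_permSum hunif hC).div_const w
  rw [charFun_apply_real, integral_map hm.aemeasurable (by fun_prop)]
  have h := integral_comp_permSum (by omega) hunif hindep hC
    fun x => Complex.exp ((t / w : ℝ) * x * Complex.I)
  have e : ∫ ω, Complex.exp (t * (C ω / w : ℝ) * Complex.I) ∂P
      = ∫ ω, Complex.exp ((t / w : ℝ) * C ω * Complex.I) ∂P := by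
    congr 1
    funext ω
    congr 2
    push_cast
    ring
  rw [e, h]
  exact norm_expect_exp_diagSum_sub_le hr hA hκ (t / w)

end Transfer

lemma Tensor.Admissible.le_scale {r n : ℕ} [NeZero n] {A : Tensor r n} {K₁ K₂ : ℝ} (hr : r ≠ 0)
    (hA : A.Admissible K₁ K₂) : K₂ ≤ A.scale := by
  have hn : (0 : ℝ) < n := by exact_mod_cast NeZero.pos n
  have h := hA.le_sum_sq
  rw [Tensor.scale, Fintype.expect_eq_sum_div_card, ← mul_div_assoc]
  simp only [Fintype.card_fun, Fintype.card_fin]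
  push_cast
  rw [le_div_iff₀ (by positivity)]
  calc K₂ * (n : ℝ) ^ r = n * (K₂ * (n : ℝ) ^ (r - 1)) := by
        rw [← pow_sub_one_mul hr]; ring
    _ ≤ _ := mul_le_mul_of_nonneg_left h hn.le

end TensorCLT

/-! ### The limit theorem -/

open TensorCLT

theorem theoremA1 (r : ℕ) (hr : 2 ≤ r)
    (A : (n : ℕ) → TensorCLT.Tensor r n)
    (K₁ K₂ : ℝ) (hK₁ : 0 < K₁) (hK₂ : 0 < K₂)
    (hA : ∀ᶠ n in atTop, (A n).Admissible K₁ K₂)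
    (Ω : ℕ → Type*) [∀ n, MeasurableSpace (Ω n)]
    (P : (n : ℕ) → Measure (Ω n)) [∀ n, IsProbabilityMeasure (P n)]
    (π : (n : ℕ) → Fin (r - 1) → Ω n → Equiv.Perm (Fin n))
    (hunif : ∀ n s, TensorCLT.IsUniformPerm (π n s) (P n))
    (hindep : ∀ n, iIndepFun (π n) (P n))
    (C : (n : ℕ) → Ω n → ℝ)
    (hC : ∀ n ω, C n ω = TensorCLT.permSum (A n) (fun s => π n s ω)) :
    TendstoInDistribution (fun n ω => C n ω / √(variance (C n) (P n))) atTop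
      (id : ℝ → ℝ) P (gaussianReal 0 1) := by
  have hmeas : ∀ n, Measurable fun ω => C n ω / √(variance (C n) (P n)) := fun n =>
    (measurable_permSum (hunif n) (hC n)).div_const _
  refine ⟨fun n => (hmeas n).aemeasurable, aemeasurable_id, ?_⟩
  refine ProbabilityMeasure.tendsto_iff_tendsto_charFun.2 fun t => ?_
  set v : ℕ → ℝ := fun n => variance (C n) (P n) with hv
  set c : ℝ := (4 * r) ^ 2 + 3 * (4 * r) with hc
  have hc0 : 0 ≤ c := by positivity
  have hinv : Tendsto (fun n : ℕ => 1 / (n : ℝ)) atTop (nhds 0) :=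
    tendsto_one_div_atTop_nhds_zero_nat
  have hsqrt : Tendsto (fun n : ℕ => 1 / √(n : ℝ)) atTop (nhds 0) := by
    have := hinv.sqrt
    simpa using this
  have hb : Tendsto (fun n : ℕ => 6 * (K₁ / √(n : ℝ)) ^ 2) atTop (nhds 0) := by
    have := ((hsqrt.const_mul K₁).pow 2).const_mul 6
    simpa [div_eq_mul_inv] using this
  have ha : Tendsto (fun n : ℕ => n * (K₁ / √(n : ℝ)) ^ 3 * c) atTop (nhds 0) := by
    have := hsqrt.const_mul (K₁ ^ 3 * c)
    rw [mul_zero] at this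
    refine this.congr' ?_
    filter_upwards [eventually_gt_atTop 0] with n hn
    have hn' : (0 : ℝ) < n := by exact_mod_cast hn
    have hs : √(n : ℝ) ≠ 0 := (Real.sqrt_pos.2 hn').ne'
    have hs2 : √(n : ℝ) ^ 2 = n := Real.sq_sqrt hn'.le
    field_simp
    rw [hs2]
  have hvs : ∀ᶠ n in atTop, |v n - (A n).scale| ≤ 6 * (K₁ / √(n : ℝ)) ^ 2 := by
    filter_upwards [hA, eventually_ne_atTop 0] with n hn hn0
    have : NeZero n := ⟨hn0⟩
    exact abs_variance_sub_scale_le hr hn.centered hn.entry_le (hunif n) (hindep n) (hC n)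
  have hvK : ∀ᶠ n in atTop, K₂ / 2 ≤ v n := by
    filter_upwards [hA, eventually_ne_atTop 0, hvs, hb.eventually_lt_const (half_pos hK₂)]
      with n hn hn0 h1 h2
    have : NeZero n := ⟨hn0⟩
    have := hn.le_scale (by omega)
    have := (abs_le.1 h1).1
    linarith
  -- `scale` need not converge; it suffices that its difference from the variance vanishes while the
  -- variance stays above K₂/2.
  have hratio : Tendsto (fun n => (A n).scale / v n) atTop (nhds 1) := by
    rw [tendsto_iff_norm_sub_tendsto_zero]
    have hlim := hb.div_const (K₂ / 2)
    rw [zero_div] at hlim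
    refine squeeze_zero' (Eventually.of_forall fun _ => norm_nonneg _) ?_ hlim
    filter_upwards [hvs, hvK] with n h1 h2
    have hvp : 0 < v n := by linarith
    rw [div_sub_one hvp.ne', norm_div, Real.norm_eq_abs, Real.norm_eq_abs, abs_of_pos hvp,
      abs_sub_comm]
    gcongr
  have hexp : Tendsto (fun n => Complex.exp (-((A n).scale * (t / √(v n) : ℝ) ^ 2 / 2))) atTop
      (nhds (Complex.exp (-(t ^ 2 / 2)))) := by
    have h1 : Tendsto (fun n => Complex.exp ((-((A n).scale / v n * t ^ 2 / 2) : ℝ) : ℂ)) atTop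
        (nhds (Complex.exp ((-(1 * t ^ 2 / 2) : ℝ) : ℂ))) :=
      (Complex.continuous_exp.comp Complex.continuous_ofReal).continuousAt.tendsto.comp
        (((hratio.mul_const _).div_const _).neg)
    have e : ((-(1 * t ^ 2 / 2) : ℝ) : ℂ) = -(t ^ 2 / 2) := by push_cast; ring
    rw [e] at h1
    refine h1.congr' ?_
    filter_upwards [hvK] with n h
    have hvp : 0 ≤ v n := by linarith
    congr 1
    rw [← Complex.ofReal_pow, div_pow, Real.sq_sqrt hvp]
    push_cast
    ring
  have hdiff : Tendsto (fun n => charFun ((P n).map fun ω => C n ω / √(v n)) t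
      - Complex.exp (-((A n).scale * (t / √(v n) : ℝ) ^ 2 / 2))) atTop (nhds 0) := by
    set T : ℝ := |t| / √(K₂ / 2) with hT
    have hlim : Tendsto (fun n : ℕ => T * (T ^ 2 * (n * (K₁ / √(n : ℝ)) ^ 3 * c)
        + T * (6 * (K₁ / √(n : ℝ)) ^ 2))) atTop (nhds 0) := by
      have := ((ha.const_mul (T ^ 2)).add (hb.const_mul T)).const_mul T
      simpa using this
    refine squeeze_zero_norm' ?_ hlim
    filter_upwards [hA, eventually_ne_atTop 0, hvK] with n hn hn0 h2
    have : NeZero n := ⟨hn0⟩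
    refine (norm_charFun_sub_le hr hn.centered hn.entry_le (hunif n) (hindep n) (hC n)
      (√(v n)) t).trans ?_
    have hK : 0 < √(K₂ / 2) := Real.sqrt_pos.2 (by linarith)
    have hle : |t / √(v n)| ≤ T := by
      rw [abs_div, abs_of_nonneg (Real.sqrt_nonneg (v n)), hT]
      gcongr
    have hT0 : 0 ≤ T := (abs_nonneg _).trans hle
    have hsq : (t / √(v n)) ^ 2 ≤ T ^ 2 := by
      rw [← sq_abs]
      gcongr
    rw [← hc]
    gcongr
  have hfin := hdiff.add hexp
  simp only [sub_add_cancel, zero_add] at hfin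
  have hlaw : charFun ((gaussianReal 0 1).map id) t = Complex.exp (-(t ^ 2 / 2)) := by
    rw [Measure.map_id, charFun_gaussianReal]
    simp
  refine Tendsto.congr (fun n => rfl) (hfin.trans (le_of_eq ?_))
  exact congrArg nhds hlaw.symm
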